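/- **Setting.** For $v\in\mathbb R^n$ write $\|v\|_n^2=\frac1n\sum_{i=1}^n v_i^2$ and $\|v\|_1=\sum_i|v_i|$. Let $D$ be the incidence matrix of the path graph on $\{1,\dots,n\}$, so that $(Df)_j=f_j-f_{j-1}$ for $j\in\{2,\dots,n\}$, and for $S\subseteq\{2,\dots,n\}$ let $\|(Df)_{-S}\|_1=\sum_{j\in\{2,\dots,n\}\setminus S}|f_j-f_{j-1}|$. Let $f^0\in\mathbb R^n$, $\sigma>0$, $\epsilon\sim\mathcal N_n(0,\sigma^2 I_n)$, $Y=f^0+\epsilon$, and for $\lambda>0$ let $$\widehat f=\arg\min_{f\in\mathbb R^n}\left\{\|Y-f\|_n^2+2\lambda\|Df\|_1\right\}.$$ Let $s\ge 0$ and let $d_1,\dots,d_{s+1}$ be positive integers with $\sum_{i=1}^{s+1}d_i=n$; put $S=\{d_1+1,\,d_1+d_2+1,\,\dots,\,d_1+\dots+d_s+1\}\subseteq\{2,\dots,n\}$ (every $S\subseteq\{2,\dots,n\}$ with $|S|=s$ is of this form for exactly one such sequence). Let $\bar\Delta_h$ be the harmonic mean of $$\Delta=\left(d_1,\lfloor d_2/2\rfloor,\lceil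 d_2/2\rceil,\dots,\lfloor d_s/2\rfloor,\lceil d_s/2\rceil,d_{s+1}\right)\in\mathbb R^{2s}$$ (for $s=0$ the term $2\gamma^2s/\bar\Delta_h$ below is read as $0$). Fix $\delta\in(0,1)$ and $\gamma>1$ and choose $\lambda=\gamma\sigma\sqrt{2\log(4(n-s-1)/\delta)/n}$. **Corollary 4.3 (Sharp oracle inequality for the path graph).** Assume $d_i\ge 4$ for all $i\in\{1,\dots,s+1\}$. Then, with probability at least $1-\delta$, $$\begin{aligned}\|\widehat f-f^0\|_n^2\le{}&\inf_{f\in\mathbb R^n}\left\{\|f-f^0\|_n^2+4\lambda\|(Df)_{-S}\|_1\right\}+\frac{8\log(2/\delta)\sigma^2}{n}+4\sigma^2\frac{s+1}{n}\\&+8\sigma^2\log\left(\frac{4(n-s-1)}{\delta}\right)\left(\frac{2\gamma^2 s}{\bar\Delta_h}+5\,\frac{s+1}{n}\log\left(\frac{n}{s+1}\right)\right).\end{aligned}$$ Moreover, there is a constant $C>0$ depending only on $\sigma,\gamma,\delta$ such that, whenever in addition $S$ equals the active set $S_0=\{j\in\{2,\dots,n\}:f^0_j\ne f^0_{j-1}\}$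 of $f^0$ and $s_0=|S_0|\ge1$, with probability at least $1-\delta$, $$\|\widehat f-f^0\|_n^2\le C\,\frac{\log(n)\,s_0}{\bar\Delta_h}+C\,\frac{\log(n)\log(n/s_0)\,s_0}{n},$$ that is, $\|\widehat f-f^0\|_n^2=\mathcal O(\log(n)\,s_0/\bar\Delta_h)+\mathcal O(\log(n)\log(n/s_0)\,s_0/n)$. -/

import Mathlib

open MeasureTheory ProbabilityTheory

/-- The squared empirical norm `‖v‖_n² = (1/n) ∑ v_i²`. -/
noncomputable def sqNorm {n : ℕ} (v : Fin n → ℝ) : ℝ :=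
  (1 / (n : ℝ)) * ∑ i, v i ^ 2

/-- The incidence matrix of the path graph with `n` vertices. The vertex `k ∈ {1, …, n}` is the
element `k - 1` of `Fin n`; row `i` (counted from `0`) belongs to the edge between the vertices
`i + 1` and `i + 2`, and that edge is labelled by its larger endpoint `i + 2 ∈ {2, …, n}`. -/
def pathIncidence (n : ℕ) : Matrix (Fin (n - 1)) (Fin n) ℝ :=
  fun i k => if k.val = i.val then -1 else if k.val = i.val + 1 then 1 else 0

/-- The total variation `‖D f‖₁` over the path graph. -/
noncomputable def pathTV {n : ℕ} (f : Fin n → ℝ) : ℝ :=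
  ∑ i, |(pathIncidence n).mulVec f i|

/-- `‖(D f)_{-S}‖₁`: the total variation over the edges whose label is not in `S ⊆ {2, …, n}`. -/
noncomputable def pathTVOff {n : ℕ} (S : Finset ℕ) (f : Fin n → ℝ) : ℝ :=
  ∑ i : Fin (n - 1) with i.val + 2 ∉ S, |(pathIncidence n).mulVec f i|

/-- The active set `{j ∈ {2, …, n} : f_j ≠ f_{j-1}}` of `f`, as a set of edge labels. -/
noncomputable def activeSet {n : ℕ} (f : Fin n → ℝ) : Finset ℕ :=
  ({i : Fin (n - 1) | (pathIncidence n).mulVec f i ≠ 0} : Finset (Fin (n - 1))).image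
    (fun i => i.val + 2)

/-- `fhat` minimises `f ↦ ‖y - f‖_n² + 2 λ ‖D f‖₁` over `ℝⁿ`. -/
def IsTVEstimator {n : ℕ} (lam : ℝ) (y fhat : Fin n → ℝ) : Prop :=
  ∀ f : Fin n → ℝ,
    sqNorm (y - fhat) + 2 * lam * pathTV fhat ≤ sqNorm (y - f) + 2 * lam * pathTV f

/-- The law `N_n(0, σ² I_n)`. -/
noncomputable def gaussianNoise (n : ℕ) (σ : ℝ) : Measure (Fin n → ℝ) :=
  Measure.pi fun _ => gaussianReal 0 ⟨σ ^ 2, sq_nonneg σ⟩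

/-- `λ = γ σ √(2 log(4 (n - s - 1) / δ) / n)`. -/
noncomputable def tuningParameter (γ σ δ : ℝ) (n s : ℕ) : ℝ :=
  γ * σ * Real.sqrt (2 * Real.log (4 * ((n : ℝ) - s - 1) / δ) / n)

/-- `S = {d₁ + 1, d₁ + d₂ + 1, …, d₁ + ⋯ + d_s + 1}`. Only `d 1, …, d s` matter. -/
def jumpSet (s : ℕ) (d : ℕ → ℕ) : Finset ℕ :=
  (Finset.Icc 1 s).image fun j => (∑ i ∈ Finset.Icc 1 j, d i) + 1

/-- `Δ = (d₁, ⌊d₂/2⌋, ⌈d₂/2⌉, …, ⌊d_s/2⌋, ⌈d_s/2⌉, d_{s+1})`, which has `2 s` entries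
if `1 ≤ s`. -/
def halfDistances (s : ℕ) (d : ℕ → ℕ) : List ℕ :=
  d 1 :: ((List.Ico 2 (s + 1)).flatMap fun j => [d j / 2, (d j + 1) / 2]) ++ [d (s + 1)]

/-- The harmonic mean of a list of positive integers. -/
noncomputable def harmonicMean (L : List ℕ) : ℝ :=
  (L.length : ℝ) / (L.map fun a => ((a : ℝ))⁻¹).sum

/-!
Write `v = fhat - f` and cut the path into the `s + 1` blocks between consecutive elements of `S`.
Strong convexity of the objective gives the basic inequality (`IsTVEstimator.basic_inequality`),
which bounds `‖fhat - f₀‖² + ‖v‖²` by `‖f - f₀‖²`, the noise term `⟨ε, v⟩` and the penalty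
difference `‖Df‖₁ - ‖D fhat‖₁`. The latter is at most `2 ‖(Df)_{-S}‖₁ + ‖(Dv)_S‖₁ - ‖(Dv)_{-S}‖₁`
(`pathTV_sub_le`).

In each block summation by parts splits the noise into its block sum and a combination of the
increments of `v` (`sum_mul_eq_mean_add_centredPartialSum`). The coefficient of the `K`-th increment
in a block of length `d` is a centred Gaussian variable with standard deviation `σ r_K`, where
`r_K = √(K (d - K) / d)`. By the choice of `λ` and a union bound over the `n - s - 1` edges off `S`,
all these coefficients are absorbed by a fraction `θ r_K < 1` of the penalty, `θ = 1 / (γ √n)`.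

It remains to compare `‖(Dv)_S‖₁` with the weighted norm `∑ (1 - θ r_K) |Dv|` left over off `S`. The
certificate `q_K = l_K (1 - θ r_K)`, with `l` a piecewise linear interpolation of the signs of the
jumps of `v`, does this: summation by parts turns the difference into `∑ |Δq| |v|`, and
`2 a |v| - v² ≤ a²` disposes of `v`. The energy `∑ (Δq)²` is at most twice that of `l`, which is the
sum of the reciprocals of the half distances (`exists_interpolation_energies`), plus `2 θ²` times
that of `r`, which is at most `5 log d` per block (`sum_sq_sub_residualNorm_le`); Jensen's
inequality for the logarithm (`sum_log_le`) sums the latter. All this is `block_bound`, added up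
over the blocks in `oracle_inequality_of_noise_le`.

The squared block sums of the noise, divided by the block lengths, add up to `σ²` times a chi-square
variable with `s + 1` degrees of freedom, which Chernoff's bound controls
(`measure_sum_sq_linear_gt_le`). The event does not depend on `f`, so that the inequality holds for
all `f` at once (`oracle_inequality_whp`); the infimum gives the oracle inequality, and `f = f₀` the
rate.
-/

/-! ### Gaussian noise: linear functionals and chi-square deviations -/

lemma gaussianNoise_eq (n : ℕ) (σ : ℝ) :
    gaussianNoise n σ = Measure.pi fun _ => gaussianReal 0 (σ ^ 2).toNNReal := by
  unfold gaussianNoise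
  have h : (⟨σ ^ 2, sq_nonneg σ⟩ : NNReal) = (σ ^ 2).toNNReal :=
    NNReal.eq (Real.coe_toNNReal _ (sq_nonneg σ)).symm
  exact congrArg (fun v : NNReal => Measure.pi fun _ : Fin n => gaussianReal 0 v) h

instance isProbabilityMeasure_gaussianNoise (n : ℕ) (σ : ℝ) :
    IsProbabilityMeasure (gaussianNoise n σ) := by
  rw [gaussianNoise_eq]; infer_instance

lemma map_eval_gaussianNoise (n : ℕ) (σ : ℝ) (i : Fin n) :
    (gaussianNoise n σ).map (fun x => x i) = gaussianReal 0 (σ ^ 2).toNNReal := by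
  rw [gaussianNoise_eq]
  exact (measurePreserving_eval (fun _ : Fin n => gaussianReal 0 (σ ^ 2).toNNReal) i).map_eq

lemma iIndepFun_eval_gaussianNoise (n : ℕ) (σ : ℝ) :
    iIndepFun (fun (i : Fin n) (x : Fin n → ℝ) => x i) (gaussianNoise n σ) := by
  rw [gaussianNoise_eq]
  exact iIndepFun_pi (X := fun _ : Fin n => (id : ℝ → ℝ)) (fun _ => aemeasurable_id)

lemma hasGaussianLaw_eval_gaussianNoise (n : ℕ) (σ : ℝ) (i : Fin n) :
    HasGaussianLaw (fun x : Fin n → ℝ => x i) (gaussianNoise n σ) :=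
  ⟨by rw [map_eval_gaussianNoise]; infer_instance⟩

lemma covariance_eval_gaussianNoise (n : ℕ) (σ : ℝ) (i j : Fin n) :
    cov[fun x => x i, fun x => x j; gaussianNoise n σ] = if i = j then σ ^ 2 else 0 := by
  split_ifs with h
  · subst h
    rw [covariance_self (measurable_pi_apply i).aemeasurable]
    have h1 : Var[fun x : Fin n → ℝ => x i; gaussianNoise n σ]
        = Var[id; (gaussianNoise n σ).map (fun x => x i)] := by
      rw [variance_map aemeasurable_id (measurable_pi_apply i).aemeasurable]; rfl
    rw [h1, map_eval_gaussianNoise, variance_id_gaussianReal,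
      Real.coe_toNNReal _ (sq_nonneg σ)]
  · exact ((iIndepFun_eval_gaussianNoise n σ).indepFun h).covariance_eq_zero
      (hasGaussianLaw_eval_gaussianNoise n σ i).memLp_two
      (hasGaussianLaw_eval_gaussianNoise n σ j).memLp_two

/-- The coordinates of `A x` are jointly Gaussian when the noise `x` is. -/
lemma hasGaussianLaw_linear_gaussianNoise {m n : ℕ} (σ : ℝ) (a : Fin m → Fin n → ℝ) :
    HasGaussianLaw (fun (x : Fin n → ℝ) b => ∑ i, a b i * x i) (gaussianNoise n σ) := by
  have h := (iIndepFun_eval_gaussianNoise n σ).hasGaussianLaw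
    (hasGaussianLaw_eval_gaussianNoise n σ)
  exact h.map_fun (LinearMap.toContinuousLinearMap (Matrix.mulVecLin (Matrix.of a)))

lemma covariance_linear_gaussianNoise {n : ℕ} (σ : ℝ) (a b : Fin n → ℝ) :
    cov[fun x => ∑ i, a i * x i, fun x => ∑ i, b i * x i; gaussianNoise n σ]
      = σ ^ 2 * ∑ i, a i * b i := by
  have hm : ∀ (c : Fin n → ℝ) i, MemLp (fun x : Fin n → ℝ => c i * x i) 2 (gaussianNoise n σ) :=
    fun c i => (hasGaussianLaw_eval_gaussianNoise n σ i).memLp_two.const_mul _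
  rw [covariance_fun_sum_fun_sum (hm a) (hm b), Finset.mul_sum]
  refine Finset.sum_congr rfl fun i _ => ?_
  simp [covariance_const_mul_left, covariance_const_mul_right, covariance_eval_gaussianNoise]
  ring

lemma map_linear_gaussianNoise {n : ℕ} (σ : ℝ) (a : Fin n → ℝ) :
    (gaussianNoise n σ).map (fun x => ∑ i, a i * x i)
      = gaussianReal 0 (σ ^ 2 * ∑ i, a i * a i).toNNReal := by
  have h : HasGaussianLaw (fun x : Fin n → ℝ => ∑ i, a i * x i) (gaussianNoise n σ) :=
    (hasGaussianLaw_linear_gaussianNoise σ (fun _ : Fin 1 => a)).eval 0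
  rw [h.map_eq_gaussianReal, ← covariance_self h.aemeasurable, covariance_linear_gaussianNoise]
  congr 1
  rw [integral_finsetSum]
  · refine Finset.sum_eq_zero fun i _ => ?_
    rw [integral_const_mul]
    have : ∫ x, x i ∂gaussianNoise n σ = ∫ y, y ∂((gaussianNoise n σ).map (fun x => x i)) := by
      rw [integral_map (measurable_pi_apply i).aemeasurable (by fun_prop)]
    rw [this, map_eval_gaussianNoise, integral_id_gaussianReal, mul_zero]
  · exact fun i _ => (hasGaussianLaw_eval_gaussianNoise n σ i).integrable.const_mul _

/-- Gaussian tail bound for a linear functional of the noise. -/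
lemma measure_abs_linear_gt_le {n : ℕ} {σ : ℝ} (hσ : 0 < σ) (a : Fin n → ℝ) {V t : ℝ}
    (hV : 0 < V) (ha : ∑ i, a i * a i = V) (ht : 0 ≤ t) :
    gaussianNoise n σ {x | σ * √V * t < |∑ i, a i * x i|}
      ≤ ENNReal.ofReal (2 * Real.exp (-t ^ 2 / 2)) := by
  set X : (Fin n → ℝ) → ℝ := fun x => ∑ i, a i * x i with hX
  have hmap := map_linear_gaussianNoise σ a
  rw [ha] at hmap
  have hsub : HasSubgaussianMGF X (σ ^ 2 * V).toNNReal (gaussianNoise n σ) := by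
    refine ⟨fun s => ?_, fun s => ?_⟩
    · rw [← mgf_pos_iff, mgf_gaussianReal hmap]
      exact Real.exp_pos _
    · rw [mgf_gaussianReal hmap]; simp
  have hpos : 0 ≤ σ * √V * t := by positivity
  have hexp : -(σ * √V * t) ^ 2 / (2 * ((σ ^ 2 * V).toNNReal : ℝ)) = -t ^ 2 / 2 := by
    rw [Real.coe_toNNReal _ (by positivity), mul_pow, mul_pow, Real.sq_sqrt hV.le]
    field_simp
  have h1 := hsub.measure_ge_le hpos
  have h2 := hsub.neg.measure_ge_le hpos
  rw [hexp] at h1 h2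
  have hsubset : {x | σ * √V * t < |X x|}
      ⊆ {x | σ * √V * t ≤ X x} ∪ {x | σ * √V * t ≤ (-X) x} := by
    intro x hx
    rcases lt_abs.1 (show σ * √V * t < |X x| from hx) with h | h
    · exact Or.inl h.le
    · exact Or.inr h.le
  rw [ENNReal.le_ofReal_iff_toReal_le (by finiteness) (by positivity)]
  refine (measureReal_mono hsubset).trans ((measureReal_union_le _ _).trans ?_)
  linarith

/-- `E exp(Z² / (4 v)) = √2` for `Z ∼ N(0, v)`. -/
lemma integral_exp_sq_gaussianReal {v : ℝ} (hv : 0 < v) :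
    ∫ z, Real.exp (1 / (4 * v) * z ^ 2) ∂(gaussianReal 0 v.toNNReal) = √2 := by
  have hv' : v.toNNReal ≠ 0 := by simpa using hv
  rw [integral_gaussianReal_eq_integral_smul hv']
  simp only [gaussianPDFReal, Real.coe_toNNReal _ hv.le, smul_eq_mul, sub_zero]
  have : ∀ z : ℝ, (√(2 * Real.pi * v))⁻¹ * Real.exp (-z ^ 2 / (2 * v))
      * Real.exp (1 / (4 * v) * z ^ 2)
      = (√(2 * Real.pi * v))⁻¹ * Real.exp (-(1 / (4 * v)) * z ^ 2) := by
    intro z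
    rw [mul_assoc, ← Real.exp_add]
    congr 2
    field_simp
    ring
  simp_rw [this]
  rw [integral_const_mul, integral_gaussian, ← Real.sqrt_inv, ← Real.sqrt_mul (by positivity)]
  congr 1
  field_simp
  norm_num

/-- The squared projection of the noise on `m` orthonormal directions is `σ²` times a chi-square
variable with `m` degrees of freedom; Chernoff's bound at `1 / (4 σ²)` gives this deviation. -/
lemma measure_sum_sq_linear_gt_le {m n : ℕ} {σ : ℝ} (hσ : 0 < σ) (a : Fin m → Fin n → ℝ)
    (ha : ∀ b c, ∑ i, a b i * a c i = if b = c then 1 else 0) (t : ℝ) :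
    gaussianNoise n σ {x | σ ^ 2 * (2 * m + 4 * t) < ∑ b, (∑ i, a b i * x i) ^ 2}
      ≤ ENNReal.ofReal (Real.exp (-t)) := by
  have hind : iIndepFun (fun b (x : Fin n → ℝ) => ∑ i, a b i * x i) (gaussianNoise n σ) := by
    refine (hasGaussianLaw_linear_gaussianNoise σ a).iIndepFun_of_covariance_eq_zero ?_
    intro b c hbc
    rw [covariance_linear_gaussianNoise, ha, if_neg hbc, mul_zero]
  have hind2 := hind.comp (fun _ z => z ^ 2) (fun _ => by fun_prop)
  have hmgf1 : ∀ b, mgf ((fun z => z ^ 2) ∘ fun x : Fin n → ℝ => ∑ i, a b i * x i)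
      (gaussianNoise n σ) (1 / (4 * σ ^ 2)) = √2 := by
    intro b
    have hmap := map_linear_gaussianNoise σ (a b)
    rw [ha, if_pos rfl, mul_one] at hmap
    rw [← integral_exp_sq_gaussianReal (pow_pos hσ 2), ← hmap,
      integral_map (Measurable.aemeasurable (by fun_prop)) (by fun_prop)]
    rfl
  have hmgf := hind2.mgf_sum (t := 1 / (4 * σ ^ 2)) (fun b => by fun_prop) Finset.univ
  simp only [hmgf1, Finset.prod_const, Finset.card_univ, Fintype.card_fin] at hmgf
  set X : (Fin n → ℝ) → ℝ := ∑ b, ((fun z => z ^ 2) ∘ fun x : Fin n → ℝ => ∑ i, a b i * x i)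
  have hXapp : ∀ x, X x = ∑ b, (∑ i, a b i * x i) ^ 2 := fun x => by simp [X]
  have hint : Integrable (fun x => Real.exp (1 / (4 * σ ^ 2) * X x)) (gaussianNoise n σ) := by
    rw [← mgf_pos_iff, hmgf]; positivity
  have h := measure_ge_le_exp_mul_mgf (σ ^ 2 * (2 * m + 4 * t)) (by positivity) hint
  rw [hmgf] at h
  rw [ENNReal.le_ofReal_iff_toReal_le (by finiteness) (by positivity)]
  refine le_trans (measureReal_mono ?_) (h.trans ?_)
  · intro x hx
    exact (hXapp x ▸ hx : σ ^ 2 * (2 * m + 4 * t) < X x).le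
  · -- the moment generating function `√2 ^ m` is paid for by the summand `2 m` of the threshold
    have h2 : √2 ≤ Real.exp (1 / 2) := by
      rw [Real.sqrt_le_left (Real.exp_pos _).le, ← Real.exp_nat_mul]
      have := Real.add_one_le_exp (1 : ℝ)
      norm_num at this ⊢
      linarith
    have h3 : √2 ^ m ≤ Real.exp (m * (1 / 2)) := by
      rw [Real.exp_nat_mul]; gcongr
    calc _ ≤ Real.exp (-(1 / (4 * σ ^ 2)) * (σ ^ 2 * (2 * m + 4 * t)))
          * Real.exp (m * (1 / 2)) := by gcongr
      _ = Real.exp (-t) := by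
        rw [← Real.exp_add]
        congr 1
        field_simp
        ring

/-! ### The inequality on a single block -/

/-- Summation by parts on a block of `m + 1` vertices. -/
lemma sum_diff_mul_eq (q u : ℕ → ℝ) (m : ℕ) :
    ∑ k ∈ Finset.range (m + 1), (q (k + 1) - q k) * u k
      = q (m + 1) * u m - q 0 * u 0 - ∑ k ∈ Finset.range m, q (k + 1) * (u (k + 1) - u k) := by
  induction m with
  | zero => simp; ring
  | succ m ih => rw [Finset.sum_range_succ, ih, Finset.sum_range_succ]; ring

/-- The centred partial sums `(K / d) ∑_{j < d} x_j - ∑_{j < K} x_j` of a block of length `d`. Up to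
normalisation this is the inner product of `x` with the residual, after projection onto the
constants, of the indicator of the tail `{K, …, d - 1}`. -/
noncomputable def centredPartialSum (d : ℕ) (x : ℕ → ℝ) (K : ℕ) : ℝ :=
  K / d * ∑ j ∈ Finset.range d, x j - ∑ j ∈ Finset.range K, x j

/-- Splitting of an inner product over a block into the part along the constants and the part
carried by the increments of `u`. -/
lemma sum_mul_eq_mean_add_centredPartialSum {d : ℕ} (hd : 0 < d) (x u : ℕ → ℝ) :
    ∑ k ∈ Finset.range d, x k * u k
      = ∑ k ∈ Finset.range d, (∑ j ∈ Finset.range d, x j) / d * u k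
        + ∑ k ∈ Finset.range (d - 1), centredPartialSum d x (k + 1) * (u (k + 1) - u k) := by
  obtain ⟨m, rfl⟩ : ∃ m, d = m + 1 := ⟨d - 1, by omega⟩
  have h := sum_diff_mul_eq (fun K => - centredPartialSum (m + 1) x K) u m
  have h0 : centredPartialSum (m + 1) x 0 = 0 := by simp [centredPartialSum]
  have h1 : centredPartialSum (m + 1) x (m + 1) = 0 := by
    have : ((m + 1 : ℕ) : ℝ) ≠ 0 := by positivity
    rw [centredPartialSum, div_self this, one_mul, sub_self]
  have h2 : ∀ k, - centredPartialSum (m + 1) x (k + 1) - - centredPartialSum (m + 1) x k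
      = x k - (∑ j ∈ Finset.range (m + 1), x j) / (m + 1 : ℕ) := by
    intro k
    simp only [centredPartialSum]
    rw [Finset.sum_range_succ _ k]
    push_cast
    ring
  simp only [h2, h0, h1, sub_mul, Finset.sum_sub_distrib, neg_mul, Finset.sum_neg_distrib] at h
  simp only [add_tsub_cancel_right]
  linarith

/-- The Euclidean norm of the residual of the indicator of `K` among `d` vertices after projection
onto the constants. -/
noncomputable def residualNorm (d K : ℕ) : ℝ := √((K : ℝ) * (d - K) / d)

lemma residualNorm_nonneg (d K : ℕ) : 0 ≤ residualNorm d K := Real.sqrt_nonneg _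

lemma residualNorm_zero (d : ℕ) : residualNorm d 0 = 0 := by simp [residualNorm]

lemma residualNorm_self (d : ℕ) : residualNorm d d = 0 := by simp [residualNorm]

lemma residualNorm_le_sqrt {d K : ℕ} (hK : K ≤ d) : residualNorm d K ≤ √d := by
  rcases Nat.eq_zero_or_pos d with rfl | hd
  · simp [residualNorm]
  have hK' : (K : ℝ) ≤ d := by exact_mod_cast hK
  have hd' : (0 : ℝ) < d := by exact_mod_cast hd
  refine Real.sqrt_le_sqrt ?_
  rw [div_le_iff₀ hd']
  nlinarith [(Nat.cast_nonneg K : (0 : ℝ) ≤ K)]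

lemma sq_sub_residualNorm_le {d k : ℕ} (hk : k < d) :
    (residualNorm d (k + 1) - residualNorm d k) ^ 2 ≤ 1 / ((k : ℝ) + 1) + 1 / ((d : ℝ) - k) := by
  rcases (show d = 1 ∨ 2 ≤ d by omega) with rfl | hd2
  · obtain rfl : k = 0 := by omega
    rw [residualNorm_self, residualNorm_zero]
    norm_num
  have hk' : (k : ℝ) + 1 ≤ d := by exact_mod_cast hk
  have hd : (2 : ℝ) ≤ d := by exact_mod_cast hd2
  have hk0 : (0 : ℝ) ≤ k := Nat.cast_nonneg k
  set D : ℝ := (d : ℝ)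
  set κ : ℝ := (k : ℝ)
  set a := (κ + 1) * (D - (κ + 1)) / D with ha
  set b := κ * (D - κ) / D with hb
  have ha0 : 0 ≤ a := div_nonneg (mul_nonneg (by linarith) (by linarith)) (by linarith)
  have hb0 : 0 ≤ b := div_nonneg (mul_nonneg (by linarith) (by linarith)) (by linarith)
  have hr : residualNorm d (k + 1) - residualNorm d k = √a - √b := by
    simp only [residualNorm]; push_cast; rfl
  rw [hr]
  have hsa := Real.sq_sqrt ha0
  have hsb := Real.sq_sqrt hb0
  have hna := Real.sqrt_nonneg a
  have hnb := Real.sqrt_nonneg b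
  have habne : 0 < a + b := by
    have : a + b = (2 * (κ + 1) * (D - κ) - (D + 1)) / D := by rw [ha, hb]; ring
    rw [this]
    refine div_pos ?_ (by linarith)
    nlinarith
  -- `(√a - √b)² (a + b) ≤ (√a - √b)² (√a + √b)² = (a - b)²`
  have h1 : (√a - √b) ^ 2 * (a + b) ≤ (a - b) ^ 2 := by
    have : (a - b) ^ 2 = (√a - √b) ^ 2 * (√a + √b) ^ 2 := by
      rw [← mul_pow, ← hsa, ← hsb]
      simp only [Real.sqrt_sq hna, Real.sqrt_sq hnb]
      ring
    rw [this]
    refine mul_le_mul_of_nonneg_left ?_ (sq_nonneg _)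
    nlinarith [mul_nonneg hna hnb]
  have h2 : (a - b) ^ 2 ≤ (1 / (κ + 1) + 1 / (D - κ)) * (a + b) := by
    have hm : 0 < D - κ := by linarith
    have hk1 : 0 < κ + 1 := by linarith
    have hD : 0 < D := by linarith
    have e1 : (a - b) ^ 2 = (D - 2 * κ - 1) ^ 2 / D ^ 2 := by
      rw [ha, hb]; field_simp; ring
    have e2 : (1 / (κ + 1) + 1 / (D - κ)) * (a + b)
        = (D + 1) * (2 - (D + 1) / ((κ + 1) * (D - κ))) / D := by
      rw [ha, hb]; field_simp; ring
    have hprod : D ≤ (κ + 1) * (D - κ) := by nlinarith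
    have h3 : (D + 1) / ((κ + 1) * (D - κ)) ≤ (D + 1) / D := by gcongr
    have h4 : (D - 2 * κ - 1) ^ 2 ≤ (D - 1) ^ 2 := by nlinarith
    rw [e1, e2]
    calc (D - 2 * κ - 1) ^ 2 / D ^ 2 ≤ (D - 1) ^ 2 / D ^ 2 := by gcongr
      _ ≤ (D + 1) * (2 - (D + 1) / D) / D := by
        rw [show (D + 1) * (2 - (D + 1) / D) / D = (D ^ 2 - 1) / D ^ 2 by field_simp; ring]
        gcongr
        nlinarith
      _ ≤ _ := by gcongr
  exact le_of_mul_le_mul_right (h1.trans h2) habne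

/-- The energy of the noise weights on a block grows only logarithmically with its length. -/
lemma sum_sq_sub_residualNorm_le {d : ℕ} (hd : 2 ≤ d) :
    ∑ k ∈ Finset.range d, (residualNorm d (k + 1) - residualNorm d k) ^ 2 ≤ 5 * Real.log d := by
  have hh : ∑ k ∈ Finset.range d, 1 / ((k : ℝ) + 1) ≤ 1 + Real.log d := by
    have := harmonic_le_one_add_log d
    rw [harmonic] at this
    push_cast at this
    simpa using this
  have hrefl : ∑ k ∈ Finset.range d, 1 / ((d : ℝ) - k)
      = ∑ k ∈ Finset.range d, 1 / ((k : ℝ) + 1) := by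
    rw [← Finset.sum_range_reflect]
    refine Finset.sum_congr rfl fun k hk => ?_
    have hk := Finset.mem_range.1 hk
    rw [show d - 1 - k = d - (k + 1) by omega, Nat.cast_sub (by omega)]
    push_cast
    congr 1
    ring
  have hlog : Real.log 2 ≤ Real.log d := Real.log_le_log (by norm_num) (by exact_mod_cast hd)
  have := Real.log_two_gt_d9
  calc _ ≤ ∑ k ∈ Finset.range d, (1 / ((k : ℝ) + 1) + 1 / ((d : ℝ) - k)) :=
        Finset.sum_le_sum fun k hk => sq_sub_residualNorm_le (Finset.mem_range.1 hk)
    _ = 2 * ∑ k ∈ Finset.range d, 1 / ((k : ℝ) + 1) := by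
        rw [Finset.sum_add_distrib, hrefl]; ring
    _ ≤ 5 * Real.log d := by linarith

/-- `HasInterpolation d c₀ c₁ E`: some function on `{0, …, d}` with values in `[-1, 1]` runs from
`c₀` to `c₁` with energy (sum of squared increments) at most `E`. -/
def HasInterpolation (d : ℕ) (c₀ c₁ E : ℝ) : Prop :=
  ∃ l : ℕ → ℝ, l 0 = c₀ ∧ l d = c₁ ∧ (∀ k ≤ d, |l k| ≤ 1) ∧
    ∑ k ∈ Finset.range d, (l (k + 1) - l k) ^ 2 ≤ E

lemma hasInterpolation_zero (d : ℕ) : HasInterpolation d 0 0 0 :=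
  ⟨fun _ => 0, rfl, rfl, by simp, by simp⟩

lemma hasInterpolation_zero_left {d : ℕ} (hd : 0 < d) {c : ℝ} (hc : |c| ≤ 1) :
    HasInterpolation d 0 c ((d : ℝ))⁻¹ := by
  have hd' : (0 : ℝ) < d := by exact_mod_cast hd
  refine ⟨fun k => c * (k / d), by simp, by simp [hd'.ne'], fun k hk => ?_, ?_⟩
  · have hk' : (k : ℝ) ≤ d := by exact_mod_cast hk
    rw [abs_mul, abs_of_nonneg (by positivity : (0 : ℝ) ≤ k / d)]
    exact mul_le_one₀ hc (by positivity) ((div_le_one hd').2 hk')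
  · have hc2 : c ^ 2 ≤ 1 := (sq_le_one_iff_abs_le_one c).2 hc
    have : ∀ k : ℕ, (c * (((k + 1 : ℕ) : ℝ) / d) - c * (k / d)) ^ 2 = c ^ 2 / d ^ 2 := by
      intro k; push_cast; ring
    simp only [this, Finset.sum_const, Finset.card_range, nsmul_eq_mul]
    calc (d : ℝ) * (c ^ 2 / d ^ 2) = c ^ 2 * (d : ℝ)⁻¹ := by field_simp
      _ ≤ 1 * (d : ℝ)⁻¹ := by gcongr
      _ = _ := one_mul _

lemma HasInterpolation.symm {d : ℕ} {c₀ c₁ E : ℝ} (h : HasInterpolation d c₀ c₁ E) :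
    HasInterpolation d c₁ c₀ E := by
  obtain ⟨l, h0, h1, hl, hE⟩ := h
  refine ⟨fun k => l (d - k), by simpa, by simpa, fun k _ => hl _ (by omega), ?_⟩
  rw [← Finset.sum_range_reflect] at hE
  refine le_of_eq_of_le (Finset.sum_congr rfl fun k hk => ?_) hE
  have hk := Finset.mem_range.1 hk
  dsimp only
  rw [show d - (k + 1) = d - 1 - k by omega, show d - k = d - 1 - k + 1 by omega]
  ring

lemma HasInterpolation.trans {a b : ℕ} {c₀ c₁ c₂ E F : ℝ} (h : HasInterpolation a c₀ c₁ E)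
    (h' : HasInterpolation b c₁ c₂ F) : HasInterpolation (a + b) c₀ c₂ (E + F) := by
  obtain ⟨l, h0, h1, hl, hE⟩ := h
  obtain ⟨l', h0', h1', hl', hF⟩ := h'
  have hl2 : ∀ k, (if a + k ≤ a then l (a + k) else l' (a + k - a)) = l' k := by
    intro k
    split_ifs with hk
    · obtain rfl : k = 0 := by omega
      simp [h0', h1]
    · rw [Nat.add_sub_cancel_left]
  refine ⟨fun k => if k ≤ a then l k else l' (k - a), by simpa, (hl2 b).trans h1',
    fun k hk => ?_, ?_⟩
  · dsimp only
    split_ifs with hka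
    · exact hl k hka
    · exact hl' _ (by omega)
  · rw [Finset.sum_range_add]
    refine add_le_add (le_of_eq_of_le (Finset.sum_congr rfl fun k hk => ?_) hE)
      (le_of_eq_of_le (Finset.sum_congr rfl fun k hk => ?_) hF)
    · have hk := Finset.mem_range.1 hk
      dsimp only
      rw [if_pos (by omega), if_pos (by omega)]
    · dsimp only
      rw [hl2, add_assoc, hl2]

/-- Between two jumps the sign pattern is interpolated through `0` at the middle of the block. -/
lemma hasInterpolation_halves {d : ℕ} (hd : 2 ≤ d) {c₀ c₁ : ℝ} (h₀ : |c₀| ≤ 1) (h₁ : |c₁| ≤ 1) :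
    HasInterpolation d c₀ c₁ (((d / 2 : ℕ) : ℝ)⁻¹ + (((d + 1) / 2 : ℕ) : ℝ)⁻¹) := by
  have h := (hasInterpolation_zero_left (d := d / 2) (by omega) h₀).symm.trans
    (hasInterpolation_zero_left (d := (d + 1) / 2) (by omega) h₁)
  rwa [show d / 2 + (d + 1) / 2 = d by omega] at h

/-- The contribution of one block. The dual certificate is `q_k = l_k (1 - θ r_k)`, where `l`
interpolates the signs of the jumps and `r` is `residualNorm`: it is dominated by the weights left
over once the increments have absorbed the noise. -/
lemma block_bound {d : ℕ} (hd : 2 ≤ d) (x u : ℕ → ℝ) {c₀ c₁ E Λ θ : ℝ}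
    (hl : HasInterpolation d c₀ c₁ E) (hΛ : 0 ≤ Λ) (hθ : 0 ≤ θ)
    (hθr : ∀ K ≤ d, θ * residualNorm d K ≤ 1)
    (hx : ∀ K, 0 < K → K < d → |centredPartialSum d x K| ≤ Λ * (θ * residualNorm d K)) :
    2 * ∑ k ∈ Finset.range d, x k * u k
        + 2 * Λ * (c₀ * u 0 - c₁ * u (d - 1) - ∑ k ∈ Finset.range (d - 1), |u (k + 1) - u k|)
        - ∑ k ∈ Finset.range d, u k ^ 2
      ≤ 2 * ((∑ k ∈ Finset.range d, x k) ^ 2 / d)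
        + 4 * Λ ^ 2 * (E + θ ^ 2 * (5 * Real.log d)) := by
  obtain ⟨l, h0, h1, hl1, hE⟩ := hl
  set r := residualNorm d with hr
  set q : ℕ → ℝ := fun k => l k * (1 - θ * r k) with hq
  have hq0 : q 0 = c₀ := by simp [hq, hr, residualNorm_zero, h0]
  have hqd : q d = c₁ := by simp [hq, hr, residualNorm_self, h1]
  set M := (∑ k ∈ Finset.range d, x k) / d with hM
  have habel := sum_diff_mul_eq q u (d - 1)
  rw [show d - 1 + 1 = d by omega, hq0, hqd] at habel
  have hnoise := sum_mul_eq_mean_add_centredPartialSum (by omega : 0 < d) x u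
  rw [← hM] at hnoise
  -- the increments inside the block have a nonpositive total weight
  have hinc : ∑ k ∈ Finset.range (d - 1), (centredPartialSum d x (k + 1) * (u (k + 1) - u k)
      - Λ * (q (k + 1) * (u (k + 1) - u k)) - Λ * |u (k + 1) - u k|) ≤ 0 := by
    refine Finset.sum_nonpos fun k hk => ?_
    have hk := Finset.mem_range.1 hk
    have hT := hx (k + 1) (by omega) (by omega)
    have h2 : |q (k + 1)| ≤ 1 - θ * r (k + 1) := by
      have hnn : 0 ≤ 1 - θ * r (k + 1) := sub_nonneg.2 (hθr _ (by omega))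
      rw [hq, abs_mul, abs_of_nonneg hnn]
      exact mul_le_of_le_one_left hnn (hl1 _ (by omega))
    set D := u (k + 1) - u k
    have h3 : centredPartialSum d x (k + 1) * D ≤ Λ * (θ * r (k + 1)) * |D| :=
      (le_abs_self _).trans (by rw [abs_mul]; gcongr)
    have h4 : -(q (k + 1) * D) ≤ (1 - θ * r (k + 1)) * |D| :=
      (neg_le_abs _).trans (by rw [abs_mul]; gcongr)
    nlinarith [mul_le_mul_of_nonneg_left h4 hΛ]
  have hvert : ∑ k ∈ Finset.range d, (2 * (M * u k) - 2 * Λ * ((q (k + 1) - q k) * u k) - u k ^ 2)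
      ≤ ∑ k ∈ Finset.range d, (2 * M ^ 2 + 2 * Λ ^ 2 * (2 * (l (k + 1) - l k) ^ 2
        + 2 * (θ ^ 2 * (r (k + 1) - r k) ^ 2))) := by
    refine Finset.sum_le_sum fun k hk => ?_
    have hk := Finset.mem_range.1 hk
    set A := (l (k + 1) - l k) * (1 - θ * r (k + 1)) with hA
    set B := l k * (θ * (r (k + 1) - r k)) with hB
    have hqAB : q (k + 1) - q k = A - B := by simp only [hq, hA, hB]; ring
    have hA2 : A ^ 2 ≤ (l (k + 1) - l k) ^ 2 := by
      rw [hA, mul_pow]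
      refine mul_le_of_le_one_right (sq_nonneg _) ?_
      have h5 := hθr (k + 1) (by omega)
      have h6 : 0 ≤ θ * r (k + 1) := mul_nonneg hθ (residualNorm_nonneg _ _)
      rw [sq_le_one_iff_abs_le_one, abs_le]
      constructor <;> linarith
    have hB2 : B ^ 2 ≤ θ ^ 2 * (r (k + 1) - r k) ^ 2 := by
      rw [hB, mul_pow, mul_pow]
      exact mul_le_of_le_one_left (by positivity)
        ((sq_le_one_iff_abs_le_one _).2 (hl1 k (by omega)))
    rw [hqAB]
    have h7 : (A - B) ^ 2 ≤ 2 * (l (k + 1) - l k) ^ 2 + 2 * (θ ^ 2 * (r (k + 1) - r k) ^ 2) := by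
      nlinarith [sq_nonneg (A + B)]
    have h8 := mul_le_mul_of_nonneg_left h7 (by positivity : 0 ≤ 2 * Λ ^ 2)
    nlinarith [sq_nonneg (M - Λ * (A - B) - u k), sq_nonneg (M + Λ * (A - B))]
  have hR := sum_sq_sub_residualNorm_le hd
  rw [← hr] at hR
  have hMd : (d : ℝ) * M ^ 2 = (∑ k ∈ Finset.range d, x k) ^ 2 / d := by
    have : (d : ℝ) ≠ 0 := by positivity
    rw [hM]; field_simp
  simp only [Finset.sum_sub_distrib, Finset.sum_add_distrib, ← Finset.mul_sum, Finset.sum_const,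
    Finset.card_range, nsmul_eq_mul] at hinc hvert hnoise
  have h9 := mul_le_mul_of_nonneg_left hR (by positivity : 0 ≤ 4 * Λ ^ 2 * θ ^ 2)
  have h10 := mul_le_mul_of_nonneg_left hE (by positivity : 0 ≤ 4 * Λ ^ 2)
  have h11 : 2 * Λ * (c₀ * u 0 - c₁ * u (d - 1)) = 2 * Λ * (-
      (∑ k ∈ Finset.range d, (q (k + 1) - q k) * u k)
      - ∑ k ∈ Finset.range (d - 1), q (k + 1) * (u (k + 1) - u k)) := by rw [habel]; ring
  rw [← hMd]
  linear_combination 2 * hinc + hvert + 2 * hnoise + h9 + h10 + h11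

/-! ### Decomposition of the path into blocks -/

/-- The number of vertices in the first `b` blocks, hence the index (from `0`) at which block `b`
starts. -/
def blockStart (d : ℕ → ℕ) (b : ℕ) : ℕ := ∑ i ∈ Finset.Icc 1 b, d i

lemma blockStart_zero (d : ℕ → ℕ) : blockStart d 0 = 0 := by simp [blockStart]

lemma blockStart_succ (d : ℕ → ℕ) (b : ℕ) : blockStart d (b + 1) = blockStart d b + d (b + 1) :=
  Finset.sum_Icc_succ_top (by omega) _

lemma blockStart_mono (d : ℕ → ℕ) : Monotone (blockStart d) :=
  monotone_nat_of_le_succ fun b => by rw [blockStart_succ]; omega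

lemma sum_range_blockStart (d : ℕ → ℕ) (F : ℕ → ℝ) (m : ℕ) :
    ∑ k ∈ Finset.range (blockStart d m), F k
      = ∑ b ∈ Finset.range m, ∑ k ∈ Finset.range (d (b + 1)), F (blockStart d b + k) := by
  induction m with
  | zero => simp [blockStart_zero]
  | succ m ih => rw [blockStart_succ, Finset.sum_range_add, ih, Finset.sum_range_succ]

/-- Each edge of the path either lies inside a block or joins two consecutive blocks. -/
lemma sum_range_blockStart_sub_one (d : ℕ → ℕ) (F : ℕ → ℝ) (s : ℕ)
    (hd : ∀ i ∈ Finset.Icc 1 (s + 1), 0 < d i) :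
    ∑ k ∈ Finset.range (blockStart d (s + 1) - 1), F k
      = ∑ b ∈ Finset.range (s + 1), ∑ k ∈ Finset.range (d (b + 1) - 1), F (blockStart d b + k)
        + ∑ j ∈ Finset.range s, F (blockStart d (j + 1) - 1) := by
  induction s with
  | zero => simp [blockStart_succ, blockStart_zero]
  | succ s ih =>
    have h1 := hd (s + 2) (Finset.mem_Icc.2 (by omega))
    have h2 := hd (s + 1) (Finset.mem_Icc.2 (by omega))
    have h3 := ih fun i hi => hd i (by simp only [Finset.mem_Icc] at *; omega)
    have h4 : 1 ≤ blockStart d (s + 1) := by rw [blockStart_succ]; omega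
    have h5 : blockStart d (s + 1 + 1) - 1
        = (blockStart d (s + 1) - 1 + 1) + (d (s + 1 + 1) - 1) := by
      have h6 : 1 ≤ d (s + 1 + 1) := h1
      rw [blockStart_succ d (s + 1), Nat.sub_add_cancel h4, Nat.add_sub_assoc h6]
    rw [h5, Finset.sum_range_add, Finset.sum_range_succ, h3, Finset.sum_range_succ _ (s + 1),
      Finset.sum_range_succ (fun j => F (blockStart d (j + 1) - 1)) s, Nat.sub_add_cancel h4]
    ring

lemma inner_edge_notMem_jumpSet {s b k : ℕ} {d : ℕ → ℕ} (hk : k < d (b + 1) - 1) :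
    blockStart d b + k + 2 ∉ jumpSet s d := by
  intro h
  obtain ⟨j, -, hj⟩ := Finset.mem_image.1 h
  have hj : blockStart d j + 1 = blockStart d b + k + 2 := hj
  have hsucc := blockStart_succ d b
  rcases Nat.lt_or_ge b j with hbj | hbj
  · have := blockStart_mono d (show b + 1 ≤ j from hbj)
    omega
  · have := blockStart_mono d hbj
    omega

lemma joining_edge_mem_jumpSet {s j : ℕ} {d : ℕ → ℕ} (hj : j < s) (hd : 0 < d (j + 1)) :
    blockStart d (j + 1) - 1 + 2 ∈ jumpSet s d := by
  refine Finset.mem_image.2 ⟨j + 1, Finset.mem_Icc.2 (by omega), ?_⟩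
  change blockStart d (j + 1) + 1 = _
  rw [blockStart_succ]
  omega

/-- A vector of `ℝⁿ` as a sequence, continued by `0`. -/
def toSeq {n : ℕ} (v : Fin n → ℝ) (k : ℕ) : ℝ := if h : k < n then v ⟨k, h⟩ else 0

lemma toSeq_val {n : ℕ} (v : Fin n → ℝ) (i : Fin n) : toSeq v i = v i := by simp [toSeq]

lemma pathIncidence_mulVec {n : ℕ} (v : Fin n → ℝ) (i : Fin (n - 1)) :
    (pathIncidence n).mulVec v i = toSeq v (i + 1) - toSeq v i := by
  have hi := i.isLt
  have h : ∀ k : Fin n, pathIncidence n i k * v k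
      = (if k = ⟨i + 1, by omega⟩ then v k else 0) - (if k = ⟨i, by omega⟩ then v k else 0) := by
    intro k
    simp only [pathIncidence, Fin.ext_iff]
    split_ifs <;> first | omega | simp
  simp only [Matrix.mulVec, dotProduct, h, Finset.sum_sub_distrib, Finset.sum_ite_eq',
    Finset.mem_univ, if_true]
  rw [toSeq, toSeq, dif_pos (by omega), dif_pos (by omega)]

/-- On `S` this is `|a| - |b| ≤ |b - a|`; off `S` it is `|a| - |b| ≤ 2 |a| - |b - a|`, which leaves
a negative multiple of the increments of `g - f`. -/
lemma pathTV_sub_le {n : ℕ} (S : Finset ℕ) (f g : Fin n → ℝ) :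
    pathTV f - pathTV g ≤ 2 * pathTVOff S f
      + ∑ i : Fin (n - 1), (if i.val + 2 ∈ S then 1 else -1) *
        |(pathIncidence n).mulVec (g - f) i| := by
  simp only [pathTV, pathTVOff, Finset.sum_filter, Finset.mul_sum, ← Finset.sum_add_distrib,
    ← Finset.sum_sub_distrib, Matrix.mulVec_sub, Pi.sub_apply]
  refine Finset.sum_le_sum fun i _ => ?_
  set a := (pathIncidence n).mulVec f i
  set b := (pathIncidence n).mulVec g i
  by_cases hi : i.val + 2 ∈ S
  · simp only [hi, not_true_eq_false, if_true, if_false]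
    have := abs_sub_abs_le_abs_sub a b
    rw [abs_sub_comm] at this
    linarith
  · simp only [hi, not_false_eq_true, if_true, if_false]
    have := abs_sub b a
    linarith

/-- The penalty of `v` on the jump set minus the penalty off it, block by block. -/
lemma sum_signed_increments_eq {n s : ℕ} {d : ℕ → ℕ} (hn : blockStart d (s + 1) = n)
    (hd : ∀ i ∈ Finset.Icc 1 (s + 1), 0 < d i) (v : Fin n → ℝ) :
    ∑ i : Fin (n - 1), (if i.val + 2 ∈ jumpSet s d then 1 else -1) *
        |(pathIncidence n).mulVec v i|
      = ∑ j ∈ Finset.range s,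
          |toSeq v (blockStart d (j + 1)) - toSeq v (blockStart d (j + 1) - 1)|
        - ∑ b ∈ Finset.range (s + 1), ∑ k ∈ Finset.range (d (b + 1) - 1),
          |toSeq v (blockStart d b + (k + 1)) - toSeq v (blockStart d b + k)| := by
  simp only [pathIncidence_mulVec]
  rw [Fin.sum_univ_eq_sum_range (fun i => (if i + 2 ∈ jumpSet s d then (1 : ℝ) else -1) *
    |toSeq v (i + 1) - toSeq v i|)]
  generalize toSeq v = V
  rw [← hn, sum_range_blockStart_sub_one d _ s hd, add_comm, sub_eq_add_neg,
    ← Finset.sum_neg_distrib]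
  congr 1
  · refine Finset.sum_congr rfl fun j hj => ?_
    have hj := Finset.mem_range.1 hj
    have hdj := hd (j + 1) (Finset.mem_Icc.2 (by omega))
    rw [if_pos (joining_edge_mem_jumpSet hj hdj), one_mul, Nat.sub_add_cancel]
    rw [blockStart_succ]
    omega
  · refine Finset.sum_congr rfl fun b _ => ?_
    rw [← Finset.sum_neg_distrib]
    refine Finset.sum_congr rfl fun k hk => ?_
    rw [if_neg (inner_edge_notMem_jumpSet (Finset.mem_range.1 hk)), neg_one_mul, add_assoc]

lemma harmonicMean_eq (L : List ℕ) :
    harmonicMean L = (L.length : ℝ) / (L.map fun a : ℕ => (a : ℝ)⁻¹).sum := by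
  -- in `harmonicMean` the coercion to `ℝ` is mapped over the list through its monad structure
  have h : (do let a ← L; pure (a : ℝ) : List ℝ) = L.map fun a : ℕ => (a : ℝ) := by
    exact List.flatMap_pure_eq_map _ _
  rw [harmonicMean, h, List.map_map]
  rfl

/-- Energies for which every sign pattern vanishing at both ends of the path can be interpolated;
their sum is the sum of the reciprocals of the half distances. -/
lemma exists_interpolation_energies (s : ℕ) (d : ℕ → ℕ)
    (hd : ∀ i ∈ Finset.Icc 1 (s + 1), 2 ≤ d i) :
    ∃ E : ℕ → ℝ, ∑ b ∈ Finset.range (s + 1), E b = 2 * s / harmonicMean (halfDistances s d) ∧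
      ∀ c : ℕ → ℝ, c 0 = 0 → c (s + 1) = 0 → (∀ j, |c j| ≤ 1) →
        ∀ b < s + 1, HasInterpolation (d (b + 1)) (c b) (c (b + 1)) (E b) := by
  rcases s with _ | t
  · refine ⟨fun _ => 0, by simp, fun c h0 h1 _ b hb => ?_⟩
    obtain rfl : b = 0 := by omega
    rw [h0, h1]
    exact hasInterpolation_zero _
  set G : ℕ → ℝ := fun j => ((d j / 2 : ℕ) : ℝ)⁻¹ + (((d j + 1) / 2 : ℕ) : ℝ)⁻¹ with hG
  have hmid : ∀ t : ℕ, ((((List.Ico 2 (t + 2)).flatMap fun j => [d j / 2, (d j + 1) / 2]).map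
      fun a => ((a : ℕ) : ℝ)⁻¹).sum = ∑ b ∈ Finset.range t, G (b + 2)) ∧
      ((List.Ico 2 (t + 2)).flatMap fun j => [d j / 2, (d j + 1) / 2]).length = 2 * t := by
    intro t
    induction t with
    | zero => simp
    | succ t ih =>
      rw [show t + 1 + 2 = (t + 2) + 1 by omega, List.Ico.succ_top (by omega)]
      rw [List.flatMap_append, List.map_append, List.sum_append, ih.1, Finset.sum_range_succ,
        List.length_append, ih.2]
      simp [hG]
      omega
  refine ⟨fun b => if b = 0 then ((d 1 : ℕ) : ℝ)⁻¹ else if b = t + 1 then ((d (t + 2) : ℕ) : ℝ)⁻¹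
    else G (b + 1), ?_, fun c h0 h1 hc b hb => ?_⟩
  · have hsum : ((halfDistances (t + 1) d).map fun a => ((a : ℕ) : ℝ)⁻¹).sum
        = ((d 1 : ℕ) : ℝ)⁻¹ + ∑ b ∈ Finset.range t, G (b + 2) + ((d (t + 2) : ℕ) : ℝ)⁻¹ := by
      rw [halfDistances, List.cons_append, List.map_cons, List.sum_cons, List.map_append,
        List.sum_append, (hmid t).1]
      simp [add_assoc]
    have hlen : (halfDistances (t + 1) d).length = 2 * (t + 1) := by
      rw [halfDistances, List.cons_append, List.length_cons, List.length_append, (hmid t).2]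
      simp
      omega
    have ht : (2 * ((t : ℝ) + 1)) ≠ 0 := by positivity
    rw [harmonicMean_eq, hsum, hlen]
    push_cast
    rw [div_div_eq_mul_div, mul_div_cancel_left₀ _ ht]
    rw [Finset.sum_range_succ, Finset.sum_range_succ']
    simp only [Nat.add_eq_zero_iff, one_ne_zero, and_false, if_false, if_true,
      Nat.add_right_cancel_iff]
    have : ∀ b ∈ Finset.range t, (if b = t then ((d (t + 2) : ℕ) : ℝ)⁻¹ else G (b + 1 + 1))
        = G (b + 2) := fun b hb => if_neg (by have := Finset.mem_range.1 hb; omega)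
    rw [Finset.sum_congr rfl this]
    ring
  · have hdb := hd (b + 1) (Finset.mem_Icc.2 (by omega))
    dsimp only
    split_ifs with hb0 hbt
    · subst hb0
      rw [h0]
      exact hasInterpolation_zero_left (by omega) (hc _)
    · subst hbt
      rw [h1]
      exact (hasInterpolation_zero_left (by omega) (hc _)).symm
    · exact hasInterpolation_halves hdb (hc _) (hc _)

lemma sum_log_le {n s : ℕ} {d : ℕ → ℕ} (hn : blockStart d (s + 1) = n)
    (hd : ∀ i ∈ Finset.Icc 1 (s + 1), 0 < d i) :
    ∑ b ∈ Finset.range (s + 1), Real.log (d (b + 1))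
      ≤ ((s : ℝ) + 1) * Real.log (n / ((s : ℝ) + 1)) := by
  have hs : (0 : ℝ) < (s : ℝ) + 1 := by positivity
  have h := strictConcaveOn_log_Ioi.concaveOn.le_map_sum (t := Finset.range (s + 1))
    (w := fun _ => 1 / ((s : ℝ) + 1)) (p := fun b => (d (b + 1) : ℝ))
    (fun _ _ => by positivity) (by simp [hs.ne'])
    (fun b hb => by
      have := hd (b + 1) (by simp only [Finset.mem_range, Finset.mem_Icc] at *; omega)
      exact Set.mem_Ioi.2 (by exact_mod_cast this))
  have hsum : ∑ b ∈ Finset.range (s + 1), (d (b + 1) : ℝ) = n := by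
    have := sum_range_blockStart d (fun _ => 1) (s + 1)
    rw [hn] at this
    simpa using this.symm
  simp only [smul_eq_mul, ← Finset.mul_sum, hsum] at h
  rw [one_div_mul_eq_div, one_div_mul_eq_div, div_le_iff₀ hs, mul_comm] at h
  exact h

/-! ### The oracle inequality for fixed noise -/

lemma natCast_mul_sqNorm {n : ℕ} (hn : 0 < n) (v : Fin n → ℝ) :
    (n : ℝ) * sqNorm v = ∑ i, v i ^ 2 := by
  have : (n : ℝ) ≠ 0 := by positivity
  rw [sqNorm]; field_simp

lemma pathTV_segment_le {n : ℕ} (f g : Fin n → ℝ) {t : ℝ} (h0 : 0 ≤ t) (h1 : t ≤ 1) :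
    pathTV (f + t • (g - f)) ≤ (1 - t) * pathTV f + t * pathTV g := by
  simp only [pathTV, Finset.mul_sum, ← Finset.sum_add_distrib]
  refine Finset.sum_le_sum fun i _ => ?_
  rw [Matrix.mulVec_add, Matrix.mulVec_smul, Matrix.mulVec_sub]
  simp only [Pi.add_apply, Pi.smul_apply, Pi.sub_apply, smul_eq_mul]
  set a := (pathIncidence n).mulVec f i
  set b := (pathIncidence n).mulVec g i
  calc |a + t * (b - a)| = |(1 - t) * a + t * b| := by ring_nf
    _ ≤ |(1 - t) * a| + |t * b| := abs_add_le _ _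
    _ = _ := by rw [abs_mul, abs_mul, abs_of_nonneg h0, abs_of_nonneg (sub_nonneg.2 h1)]

/-- The basic inequality. The estimator minimises a strongly convex function, so that moving from
the estimator to `f` costs at least `‖fhat - f‖²`. -/
lemma IsTVEstimator.basic_inequality {n : ℕ} (hn : 0 < n) {lam : ℝ} (hlam : 0 ≤ lam)
    {f₀ ε fhat : Fin n → ℝ} (h : IsTVEstimator lam (f₀ + ε) fhat) (f : Fin n → ℝ) :
    ∑ i, (fhat - f₀) i ^ 2 + ∑ i, (fhat - f) i ^ 2
      ≤ ∑ i, (f - f₀) i ^ 2 + 2 * ∑ i, ε i * (fhat - f) i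
        + 2 * (lam * n) * (pathTV f - pathTV fhat) := by
  set B := ∑ i, (f₀ + ε - fhat) i * (f - fhat) i with hB
  set C := ∑ i, (f - fhat) i ^ 2 with hC
  have hC0 : 0 ≤ C := Finset.sum_nonneg fun _ _ => sq_nonneg _
  have hlin : ∀ t : ℝ, 0 < t → t ≤ 1 →
      2 * B ≤ t * C + 2 * (lam * n) * (pathTV f - pathTV fhat) := by
    intro t ht0 ht1
    have h1 := mul_le_mul_of_nonneg_left (h (fhat + t • (f - fhat)))
      (Nat.cast_nonneg n : (0 : ℝ) ≤ n)
    rw [mul_add, mul_add, natCast_mul_sqNorm hn, natCast_mul_sqNorm hn] at h1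
    have h2 := mul_le_mul_of_nonneg_left (pathTV_segment_le fhat f ht0.le ht1)
      (by positivity : 0 ≤ 2 * (lam * n))
    have h3 : ∑ i, (f₀ + ε - (fhat + t • (f - fhat))) i ^ 2
        = ∑ i, (f₀ + ε - fhat) i ^ 2 - 2 * t * B + t ^ 2 * C := by
      rw [hB, hC, Finset.mul_sum, Finset.mul_sum, ← Finset.sum_sub_distrib,
        ← Finset.sum_add_distrib]
      refine Finset.sum_congr rfl fun i _ => ?_
      simp only [Pi.sub_apply, Pi.add_apply, Pi.smul_apply, smul_eq_mul]
      ring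
    rw [h3] at h1
    refine le_of_mul_le_mul_left ?_ ht0
    linear_combination h1 + h2
  -- the limit `t → 0`
  have hopt : 2 * B ≤ 2 * (lam * n) * (pathTV f - pathTV fhat) := by
    refine le_of_forall_pos_le_add fun η hη => ?_
    have hpos : 0 < η / (C + 1) := by positivity
    have h1 := hlin (min 1 (η / (C + 1))) (lt_min one_pos hpos) (min_le_left _ _)
    have h2 : min 1 (η / (C + 1)) * C ≤ η / (C + 1) * (C + 1) :=
      mul_le_mul (min_le_right _ _) (by linarith) hC0 hpos.le
    rw [div_mul_cancel₀ _ (by positivity)] at h2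
    linarith
  have hid : ∑ i, (fhat - f₀) i ^ 2 + ∑ i, (fhat - f) i ^ 2
      = ∑ i, (f - f₀) i ^ 2 + 2 * ∑ i, ε i * (fhat - f) i + 2 * B := by
    rw [hB, Finset.mul_sum, Finset.mul_sum]
    simp only [← Finset.sum_add_distrib]
    refine Finset.sum_congr rfl fun i _ => ?_
    simp only [Pi.sub_apply, Pi.add_apply]
    ring
  linarith

lemma exists_sign (x : ℝ) : ∃ c : ℝ, |c| ≤ 1 ∧ c * x = |x| := by
  rcases le_total 0 x with h | h
  · exact ⟨1, by simp, by rw [abs_of_nonneg h, one_mul]⟩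
  · exact ⟨-1, by simp, by rw [abs_of_nonpos h, neg_one_mul]⟩

/-- The oracle inequality on the event that the noise within each block is dominated by its
weights; only the block sums of the noise remain on the right-hand side. -/
lemma oracle_inequality_of_noise_le {n s : ℕ} {d : ℕ → ℕ} (hn : blockStart d (s + 1) = n)
    (hd : ∀ i ∈ Finset.Icc 1 (s + 1), 2 ≤ d i) {γ lam : ℝ} (hγ : 1 < γ) (hlam : 0 ≤ lam)
    {f₀ ε fhat : Fin n → ℝ} (hf : IsTVEstimator lam (f₀ + ε) fhat)
    (hε : ∀ b < s + 1, ∀ K, 0 < K → K < d (b + 1) →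
      |centredPartialSum (d (b + 1)) (fun j => toSeq ε (blockStart d b + j)) K|
        ≤ lam * √n / γ * residualNorm (d (b + 1)) K) (f : Fin n → ℝ) :
    n * sqNorm (fhat - f₀) ≤ n * sqNorm (f - f₀) + 4 * (lam * n) * pathTVOff (jumpSet s d) f
      + 2 * ∑ b ∈ Finset.range (s + 1),
        (∑ k ∈ Finset.range (d (b + 1)), toSeq ε (blockStart d b + k)) ^ 2 / d (b + 1)
      + 4 * (lam * n) ^ 2 * (2 * s / harmonicMean (halfDistances s d)
        + 1 / (γ ^ 2 * n) * (5 * (((s : ℝ) + 1) * Real.log (n / ((s : ℝ) + 1))))) := by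
  have hd0 : ∀ i ∈ Finset.Icc 1 (s + 1), 0 < d i := fun i hi => by have := hd i hi; omega
  have hdb : ∀ b < s + 1, 2 ≤ d (b + 1) := fun b hb => hd _ (Finset.mem_Icc.2 (by omega))
  have hn0 : 0 < n := by
    have := hdb s (by omega)
    rw [← hn, blockStart_succ]
    omega
  have hnR : (0 : ℝ) < n := by exact_mod_cast hn0
  have hγ0 : 0 < γ := by linarith
  have hsqrt : 0 < √(n : ℝ) := Real.sqrt_pos.2 hnR
  have hsq : √(n : ℝ) * √(n : ℝ) = n := Real.mul_self_sqrt hnR.le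
  set Λ := lam * n with hΛ
  set θ := 1 / (γ * √n) with hθ
  have hΛθ : Λ * θ = lam * √n / γ := by
    rw [hΛ, hθ]; nth_rewrite 1 [← hsq]; field_simp
  have hθ2 : θ ^ 2 = 1 / (γ ^ 2 * n) := by
    rw [hθ, div_pow, mul_pow, one_pow, Real.sq_sqrt hnR.le]
  have hΛ0 : 0 ≤ Λ := by positivity
  have hθ0 : 0 ≤ θ := by positivity
  set v := fhat - f with hv
  obtain ⟨E, hE, hinterp⟩ := exists_interpolation_energies s d hd
  choose sgn hsgn1 hsgn using exists_sign
  -- the signs of the jumps of `v`, and `0` at the two ends of the path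
  set c : ℕ → ℝ := fun b => if b = 0 ∨ b = s + 1 then 0
    else sgn (toSeq v (blockStart d b) - toSeq v (blockStart d b - 1)) with hc
  have hc0 : c 0 = 0 := by simp [hc]
  have hcs : c (s + 1) = 0 := by simp [hc]
  have hc1 : ∀ b, |c b| ≤ 1 := by
    intro b
    simp only [hc]
    split_ifs
    · simp
    · exact hsgn1 _
  have hblocks := Finset.sum_le_sum fun b (hb : b ∈ Finset.range (s + 1)) =>
    block_bound (hdb b (Finset.mem_range.1 hb)) (fun j => toSeq ε (blockStart d b + j))
      (fun j => toSeq v (blockStart d b + j)) (hinterp c hc0 hcs hc1 b (Finset.mem_range.1 hb))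
      hΛ0 hθ0
      (fun K hK => by
        have hle : d (b + 1) ≤ n := by
          rw [← hn]
          refine le_trans ?_ (blockStart_mono d (Nat.succ_le_of_lt (Finset.mem_range.1 hb)))
          rw [Nat.succ_eq_add_one, blockStart_succ]
          omega
        have h1 : residualNorm (d (b + 1)) K ≤ √n :=
          (residualNorm_le_sqrt hK).trans (Real.sqrt_le_sqrt (by exact_mod_cast hle))
        calc θ * residualNorm (d (b + 1)) K ≤ θ * √n := by gcongr
          _ = 1 / γ := by rw [hθ]; field_simp
          _ ≤ 1 := (div_le_one hγ0).2 hγ.le)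
      (fun K hK0 hK => by
        rw [← mul_assoc, hΛθ]
        exact hε b (Finset.mem_range.1 hb) K hK0 hK)
  simp only [add_zero, Finset.sum_add_distrib, Finset.sum_sub_distrib, ← Finset.mul_sum] at hblocks
  have hjump : ∑ b ∈ Finset.range (s + 1), c b * toSeq v (blockStart d b)
      - ∑ b ∈ Finset.range (s + 1), c (b + 1) * toSeq v (blockStart d b + (d (b + 1) - 1))
      = ∑ j ∈ Finset.range s,
          |toSeq v (blockStart d (j + 1)) - toSeq v (blockStart d (j + 1) - 1)| := by
    rw [Finset.sum_range_succ', Finset.sum_range_succ _ s, hc0, hcs, zero_mul, zero_mul, add_zero,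
      add_zero, ← Finset.sum_sub_distrib]
    refine Finset.sum_congr rfl fun j hj => ?_
    have hj := Finset.mem_range.1 hj
    have h2 := hdb j (by omega)
    rw [← Nat.add_sub_assoc (by omega), ← blockStart_succ, ← mul_sub, ← hsgn]
    congr 1
    simp only [hc]
    rw [if_neg (by omega)]
  have hsum : ∀ F : ℕ → ℝ, ∑ i : Fin n, F i = ∑ b ∈ Finset.range (s + 1),
      ∑ k ∈ Finset.range (d (b + 1)), F (blockStart d b + k) := by
    intro F
    rw [Fin.sum_univ_eq_sum_range, ← sum_range_blockStart, hn]
  have hnoise := hsum (fun k => toSeq ε k * toSeq v k)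
  have hsqv := hsum (fun k => toSeq v k ^ 2)
  simp only [toSeq_val] at hnoise hsqv
  have hbasic := hf.basic_inequality hn0 hlam f
  rw [← hv, ← hΛ] at hbasic
  have hTV := pathTV_sub_le (jumpSet s d) f fhat
  rw [← hv, sum_signed_increments_eq hn hd0] at hTV
  have hTV2 := mul_le_mul_of_nonneg_left hTV (by positivity : 0 ≤ 2 * Λ)
  have hlog := mul_le_mul_of_nonneg_left (sum_log_le hn hd0)
    (by positivity : 0 ≤ 4 * Λ ^ 2 * θ ^ 2 * 5)
  rw [natCast_mul_sqNorm hn0, natCast_mul_sqNorm hn0, ← hθ2, ← hE]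
  rw [← hnoise, hjump, ← hsqv] at hblocks
  -- the terms in `v ^ 2` and in the increments of `v` cancel
  linear_combination hbasic + hTV2 + hblocks + hlog

/-! ### Probability of the noise event -/

/-- The weights `w` placed on the block of `d` vertices that starts at `p`. -/
def blockCoeff (n p d : ℕ) (w : ℕ → ℝ) (i : Fin n) : ℝ :=
  if p ≤ i.val ∧ i.val < p + d then w (i.val - p) else 0

lemma sum_ite_block {n p d : ℕ} (h : p + d ≤ n) (F : ℕ → ℝ) :
    ∑ i : Fin n, (if p ≤ i.val ∧ i.val < p + d then F i.val else 0)
      = ∑ k ∈ Finset.range d, F (p + k) := by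
  rw [Fin.sum_univ_eq_sum_range (fun i => if p ≤ i ∧ i < p + d then F i else 0),
    ← Finset.sum_filter]
  have : (Finset.range n).filter (fun i => p ≤ i ∧ i < p + d) = Finset.Ico p (p + d) := by
    ext i
    simp only [Finset.mem_filter, Finset.mem_range, Finset.mem_Ico]
    omega
  rw [this, Finset.sum_Ico_eq_sum_range, Nat.add_sub_cancel_left]

lemma sum_blockCoeff_mul {n p d : ℕ} (h : p + d ≤ n) (w : ℕ → ℝ) (x : Fin n → ℝ) :
    ∑ i, blockCoeff n p d w i * x i = ∑ k ∈ Finset.range d, w k * toSeq x (p + k) := by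
  have h1 := sum_ite_block h (fun k => w (k - p) * toSeq x k)
  simp only [toSeq_val, Nat.add_sub_cancel_left] at h1
  rw [← h1]
  refine Finset.sum_congr rfl fun i _ => ?_
  rw [blockCoeff, ite_mul, zero_mul]

lemma sum_blockCoeff_mul_self {n p d : ℕ} (h : p + d ≤ n) (w : ℕ → ℝ) :
    ∑ i, blockCoeff n p d w i * blockCoeff n p d w i = ∑ k ∈ Finset.range d, w k * w k := by
  have h1 := sum_ite_block h (fun k => w (k - p) * w (k - p))
  simp only [Nat.add_sub_cancel_left] at h1
  rw [← h1]
  refine Finset.sum_congr rfl fun i _ => ?_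
  rw [blockCoeff]
  split_ifs <;> simp

lemma sum_range_ite_lt {d K : ℕ} (hK : K ≤ d) (F : ℕ → ℝ) :
    ∑ k ∈ Finset.range d, (if k < K then F k else 0) = ∑ k ∈ Finset.range K, F k := by
  rw [← Finset.sum_filter]
  congr 1
  ext k
  simp only [Finset.mem_filter, Finset.mem_range]
  omega

/-- The centred partial sum of the noise is Gaussian with standard deviation
`σ * residualNorm d K`. -/
lemma measure_centredPartialSum_gt_le {n p d K : ℕ} {σ t : ℝ} (hσ : 0 < σ) (ht : 0 ≤ t)
    (h : p + d ≤ n) (hK0 : 0 < K) (hK : K < d) :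
    gaussianNoise n σ {x | σ * t * residualNorm d K
        < |centredPartialSum d (fun j => toSeq x (p + j)) K|}
      ≤ ENNReal.ofReal (2 * Real.exp (-t ^ 2 / 2)) := by
  have hd : (0 : ℝ) < d := by exact_mod_cast hK0.trans hK
  have hK' : (K : ℝ) < d := by exact_mod_cast hK
  have hK0' : (0 : ℝ) < K := by exact_mod_cast hK0
  set w : ℕ → ℝ := fun k => K / d - (if k < K then 1 else 0) with hw
  have hV : 0 < (K : ℝ) * (d - K) / d := div_pos (mul_pos hK0' (by linarith)) hd
  have hsq : ∑ i, blockCoeff n p d w i * blockCoeff n p d w i = (K : ℝ) * (d - K) / d := by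
    have h1 : ∀ k, w k * w k
        = (K : ℝ) / d * (K / d) + (if k < K then (1 - 2 * (K / d) : ℝ) else 0) := by
      intro k
      simp only [hw]
      split_ifs <;> ring
    rw [sum_blockCoeff_mul_self h]
    simp only [h1, Finset.sum_add_distrib]
    rw [sum_range_ite_lt hK.le]
    simp only [Finset.sum_const, Finset.card_range, nsmul_eq_mul]
    field_simp
    ring
  have hlin : ∀ x : Fin n → ℝ, ∑ i, blockCoeff n p d w i * x i
      = centredPartialSum d (fun j => toSeq x (p + j)) K := by
    intro x
    rw [sum_blockCoeff_mul h, centredPartialSum, ← sum_range_ite_lt hK.le, Finset.mul_sum,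
      ← Finset.sum_sub_distrib]
    refine Finset.sum_congr rfl fun k _ => ?_
    simp only [hw]
    split_ifs <;> ring
  have hmain := measure_abs_linear_gt_le hσ _ hV hsq ht
  simp only [hlin] at hmain
  rw [show σ * t * residualNorm d K = σ * √((K : ℝ) * (d - K) / d) * t by
    rw [residualNorm]; ring]
  exact hmain

lemma blockStart_add_le {n s b : ℕ} {d : ℕ → ℕ} (hn : blockStart d (s + 1) = n) (hb : b < s + 1) :
    blockStart d b + d (b + 1) ≤ n := by
  rw [← hn, ← blockStart_succ]
  exact blockStart_mono d hb

/-- Deviation of the projection of the noise on the vectors that are constant on each block. -/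
lemma measure_sum_block_sums_gt_le {n s : ℕ} {d : ℕ → ℕ} {σ : ℝ} (hσ : 0 < σ)
    (hn : blockStart d (s + 1) = n) (hd : ∀ i ∈ Finset.Icc 1 (s + 1), 0 < d i) (t : ℝ) :
    gaussianNoise n σ {x | σ ^ 2 * (2 * (s + 1) + 4 * t) < ∑ b ∈ Finset.range (s + 1),
        (∑ k ∈ Finset.range (d (b + 1)), toSeq x (blockStart d b + k)) ^ 2 / d (b + 1)}
      ≤ ENNReal.ofReal (Real.exp (-t)) := by
  set a : Fin (s + 1) → Fin n → ℝ := fun b =>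
    blockCoeff n (blockStart d b) (d (b + 1)) (fun _ => 1 / √(d (b + 1))) with ha
  have hdpos : ∀ b : Fin (s + 1), (0 : ℝ) < d (b + 1) := fun b => by
    exact_mod_cast hd _ (Finset.mem_Icc.2 (by have := b.isLt; omega))
  have horth : ∀ b c, ∑ i, a b i * a c i = if b = c then 1 else 0 := by
    intro b c
    split_ifs with hbc
    · subst hbc
      have := hdpos b
      rw [ha, sum_blockCoeff_mul_self (blockStart_add_le hn b.isLt), Finset.sum_const,
        Finset.card_range, nsmul_eq_mul, ← mul_div_mul_comm, Real.mul_self_sqrt this.le]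
      field_simp
    · refine Finset.sum_eq_zero fun i _ => ?_
      have hdisj : ∀ b c : ℕ, b < c → i.val < blockStart d b + d (b + 1) →
          ¬ blockStart d c ≤ i.val := by
        intro b c hlt h1 h2
        have := blockStart_mono d (show b + 1 ≤ c from hlt)
        rw [blockStart_succ] at this
        omega
      simp only [ha, blockCoeff]
      split_ifs with h1 h2
      · rcases lt_or_gt_of_ne (fun h => hbc (Fin.ext h) : b.val ≠ c.val) with hlt | hlt
        · exact absurd h2.1 (hdisj _ _ hlt h1.2)
        · exact absurd h1.1 (hdisj _ _ hlt h2.2)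
      all_goals simp
  have hmain := measure_sum_sq_linear_gt_le hσ a horth t
  have hsum : ∀ x : Fin n → ℝ, ∑ b, (∑ i, a b i * x i) ^ 2 = ∑ b ∈ Finset.range (s + 1),
      (∑ k ∈ Finset.range (d (b + 1)), toSeq x (blockStart d b + k)) ^ 2 / d (b + 1) := by
    intro x
    rw [Finset.sum_range]
    refine Finset.sum_congr rfl fun b _ => ?_
    rw [ha, sum_blockCoeff_mul (blockStart_add_le hn b.isLt), ← Finset.mul_sum, mul_pow, div_pow,
      Real.sq_sqrt (hdpos b).le]
    ring
  simp only [hsum] at hmain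
  push_cast at hmain
  exact hmain

/-- The oracle inequality holds simultaneously for all `f` with probability at least `1 - δ`. -/
lemma oracle_inequality_whp {σ γ δ : ℝ} (hσ : 0 < σ) (hγ : 1 < γ) (hδ₀ : 0 < δ) (hδ₁ : δ < 1)
    {n s : ℕ} {d : ℕ → ℕ} (hn : blockStart d (s + 1) = n)
    (hd : ∀ i ∈ Finset.Icc 1 (s + 1), 4 ≤ d i) (f₀ : Fin n → ℝ) {Ω : Type*} [MeasurableSpace Ω]
    (P : Measure Ω) [IsProbabilityMeasure P] {ε fhat : Ω → Fin n → ℝ}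
    (hε : HasLaw ε (gaussianNoise n σ) P)
    (hf : ∀ ω, IsTVEstimator (tuningParameter γ σ δ n s) (f₀ + ε ω) (fhat ω)) :
    ENNReal.ofReal (1 - δ) ≤ P {ω | ∀ f : Fin n → ℝ, sqNorm (fhat ω - f₀) ≤
      sqNorm (f - f₀) + 4 * tuningParameter γ σ δ n s * pathTVOff (jumpSet s d) f
        + 8 * Real.log (2 / δ) * σ ^ 2 / n + 4 * σ ^ 2 * (((s : ℝ) + 1) / n)
        + 8 * σ ^ 2 * Real.log (4 * ((n : ℝ) - s - 1) / δ) *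
          (2 * γ ^ 2 * s / harmonicMean (halfDistances s d)
            + 5 * (((s : ℝ) + 1) / n) * Real.log (n / ((s : ℝ) + 1)))} := by
  have hdb : ∀ b < s + 1, 4 ≤ d (b + 1) := fun b hb => hd _ (Finset.mem_Icc.2 (by omega))
  -- the number of edges inside the blocks
  have hcount : ∑ b ∈ Finset.range (s + 1), ((d (b + 1) : ℝ) - 1) = (n : ℝ) - s - 1 := by
    have := sum_range_blockStart d (fun _ => 1) (s + 1)
    rw [hn] at this
    simp only [Finset.sum_const, Finset.card_range, nsmul_eq_mul, mul_one] at this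
    rw [Finset.sum_sub_distrib, ← this]
    simp
    ring
  have hN : (3 : ℝ) ≤ (n : ℝ) - s - 1 := by
    rw [← hcount]
    calc (3 : ℝ) ≤ (s + 1 : ℕ) * 3 := by push_cast; nlinarith [(Nat.cast_nonneg s : (0 : ℝ) ≤ s)]
      _ = ∑ b ∈ Finset.range (s + 1), (3 : ℝ) := by simp
      _ ≤ _ := Finset.sum_le_sum fun b hb => by
        have : (4 : ℝ) ≤ d (b + 1) := by exact_mod_cast hdb b (Finset.mem_range.1 hb)
        linarith
  have hnR : (0 : ℝ) < n := by linarith [(Nat.cast_nonneg s : (0 : ℝ) ≤ s)]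
  set N : ℝ := (n : ℝ) - s - 1 with hNdef
  set L := Real.log (4 * N / δ) with hL
  have hL0 : 0 ≤ L := Real.log_nonneg (by rw [le_div_iff₀ hδ₀]; linarith)
  set lam := tuningParameter γ σ δ n s with hlam
  have hlam' : lam = γ * σ * √(2 * L / n) := rfl
  have hγ0 : 0 < γ := by linarith
  have hlam0 : 0 ≤ lam := by rw [hlam']; positivity
  have hlamn : lam * √n / γ = σ * √(2 * L) := by
    rw [hlam', Real.sqrt_div (by positivity)]
    have := Real.sqrt_pos.2 hnR
    field_simp
  have hlam2 : (lam * n) ^ 2 = 2 * γ ^ 2 * σ ^ 2 * L * n := by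
    rw [hlam', mul_pow, mul_pow, mul_pow, Real.sq_sqrt (by positivity)]
    field_simp
  -- `B₁`: some partial sum of the noise exceeds its weight; `B₂`: the block sums are too large
  set B₁ : Set (Fin n → ℝ) := ⋃ b ∈ Finset.range (s + 1), ⋃ K ∈ Finset.Ico 1 (d (b + 1)),
    {x | σ * √(2 * L) * residualNorm (d (b + 1)) K
      < |centredPartialSum (d (b + 1)) (fun j => toSeq x (blockStart d b + j)) K|} with hB₁
  set B₂ : Set (Fin n → ℝ) := {x | σ ^ 2 * (2 * (s + 1) + 4 * Real.log (2 / δ)) <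
    ∑ b ∈ Finset.range (s + 1),
      (∑ k ∈ Finset.range (d (b + 1)), toSeq x (blockStart d b + k)) ^ 2 / d (b + 1)} with hB₂
  have hB₁le : gaussianNoise n σ B₁ ≤ ENNReal.ofReal (δ / 2) := by
    have hexp : 2 * Real.exp (-√(2 * L) ^ 2 / 2) = δ / (2 * N) := by
      rw [Real.sq_sqrt (by positivity), show -(2 * L) / 2 = -L by ring, Real.exp_neg, hL,
        Real.exp_log (by positivity)]
      field_simp
      norm_num
    calc gaussianNoise n σ B₁
        ≤ ∑ b ∈ Finset.range (s + 1), ∑ K ∈ Finset.Ico 1 (d (b + 1)),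
          ENNReal.ofReal (δ / (2 * N)) := by
          refine (measure_biUnion_finset_le _ _).trans (Finset.sum_le_sum fun b hb => ?_)
          refine (measure_biUnion_finset_le _ _).trans (Finset.sum_le_sum fun K hK => ?_)
          obtain ⟨hK1, hK2⟩ := Finset.mem_Ico.1 hK
          rw [← hexp]
          exact measure_centredPartialSum_gt_le hσ (Real.sqrt_nonneg _)
            (blockStart_add_le hn (Finset.mem_range.1 hb)) hK1 hK2
      _ = ENNReal.ofReal (∑ b ∈ Finset.range (s + 1), ∑ K ∈ Finset.Ico 1 (d (b + 1)),
          δ / (2 * N)) := by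
          have hpos : 0 ≤ δ / (2 * N) := by positivity
          rw [ENNReal.ofReal_sum_of_nonneg fun _ _ => Finset.sum_nonneg fun _ _ => hpos]
          exact Finset.sum_congr rfl fun _ _ => (ENNReal.ofReal_sum_of_nonneg fun _ _ => hpos).symm
      _ = ENNReal.ofReal (δ / 2) := by
          congr 1
          simp only [Finset.sum_const, Nat.card_Ico, nsmul_eq_mul]
          rw [← Finset.sum_mul, Finset.sum_congr rfl fun b hb => Nat.cast_sub (R := ℝ)
            (by have := hdb b (Finset.mem_range.1 hb); omega : 1 ≤ d (b + 1)), Nat.cast_one, hcount]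
          field_simp
  have hB₂le : gaussianNoise n σ B₂ ≤ ENNReal.ofReal (δ / 2) := by
    have h := measure_sum_block_sums_gt_le hσ hn (fun i hi => by have := hd i hi; omega)
      (Real.log (2 / δ))
    rwa [Real.exp_neg, Real.exp_log (by positivity), inv_div] at h
  have hbad : P (ε ⁻¹' (B₁ ∪ B₂)) ≤ ENNReal.ofReal δ := by
    calc P (ε ⁻¹' (B₁ ∪ B₂)) ≤ gaussianNoise n σ (B₁ ∪ B₂) := by
          rw [← hε.map_eq]
          exact Measure.le_map_apply hε.aemeasurable _
      _ ≤ ENNReal.ofReal (δ / 2) + ENNReal.ofReal (δ / 2) :=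
          (measure_union_le _ _).trans (add_le_add hB₁le hB₂le)
      _ = ENNReal.ofReal δ := by
          rw [← ENNReal.ofReal_add (by positivity) (by positivity), add_halves]
  set A := {ω | ∀ f : Fin n → ℝ, sqNorm (fhat ω - f₀) ≤
      sqNorm (f - f₀) + 4 * lam * pathTVOff (jumpSet s d) f
        + 8 * Real.log (2 / δ) * σ ^ 2 / n + 4 * σ ^ 2 * (((s : ℝ) + 1) / n)
        + 8 * σ ^ 2 * L *
          (2 * γ ^ 2 * s / harmonicMean (halfDistances s d)
            + 5 * (((s : ℝ) + 1) / n) * Real.log (n / ((s : ℝ) + 1)))} with hA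
  have hcover : Set.univ ⊆ A ∪ ε ⁻¹' (B₁ ∪ B₂) := by
    intro ω _
    by_cases hω : ε ω ∈ B₁ ∪ B₂
    · exact Or.inr hω
    refine Or.inl fun f => ?_
    have hω₁ : ε ω ∉ B₁ := fun h => hω (Or.inl h)
    have hω₂ : ¬ ε ω ∈ B₂ := fun h => hω (Or.inr h)
    rw [hB₂, Set.mem_ofPred_eq] at hω₂
    simp only [hB₁, Set.mem_iUnion, not_exists] at hω₁
    have h1 := oracle_inequality_of_noise_le hn (fun i hi => by have := hd i hi; omega) hγ hlam0
      (hf ω) (fun b hb K hK0 hK => by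
        rw [hlamn]
        exact not_lt.1 (hω₁ b (Finset.mem_range.2 hb) K (Finset.mem_Ico.2 ⟨hK0, hK⟩))) f
    have h2 := not_lt.1 hω₂
    rw [hlam2] at h1
    refine le_of_mul_le_mul_left (h1.trans ?_) hnR
    set H := harmonicMean (halfDistances s d)
    set W := ∑ b ∈ Finset.range (s + 1), (∑ k ∈ Finset.range (d (b + 1)),
      toSeq (ε ω) (blockStart d b + k)) ^ 2 / (d (b + 1) : ℝ)
    set J := Real.log ((n : ℝ) / ((s : ℝ) + 1))
    have e1 : (n : ℝ) * (sqNorm (f - f₀) + 4 * lam * pathTVOff (jumpSet s d) f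
        + 8 * Real.log (2 / δ) * σ ^ 2 / n + 4 * σ ^ 2 * (((s : ℝ) + 1) / n)
        + 8 * σ ^ 2 * L * (2 * γ ^ 2 * s / H + 5 * (((s : ℝ) + 1) / n) * J))
        = n * sqNorm (f - f₀) + 4 * (lam * n) * pathTVOff (jumpSet s d) f
          + 2 * (σ ^ 2 * (2 * (s + 1) + 4 * Real.log (2 / δ)))
          + 4 * (2 * γ ^ 2 * σ ^ 2 * L * n) * (2 * s / H
            + 1 / (γ ^ 2 * n) * (5 * (((s : ℝ) + 1) * J))) := by
      rw [div_eq_mul_inv _ H, div_eq_mul_inv _ H]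
      field_simp
      ring
    rw [e1]
    linarith
  have h1 : (1 : ENNReal) ≤ P A + ENNReal.ofReal δ := by
    calc (1 : ENNReal) = P Set.univ := measure_univ.symm
      _ ≤ P A + P (ε ⁻¹' (B₁ ∪ B₂)) := (measure_mono hcover).trans (measure_union_le _ _)
      _ ≤ _ := by gcongr
  rw [ENNReal.ofReal_sub _ hδ₀.le, ENNReal.ofReal_one]
  exact tsub_le_iff_right.2 h1

/-! ### The oracle inequality and the rate -/

lemma pathTVOff_activeSet {n : ℕ} (f : Fin n → ℝ) : pathTVOff (activeSet f) f = 0 := by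
  refine Finset.sum_eq_zero fun i hi => ?_
  rw [abs_eq_zero]
  by_contra h
  refine (Finset.mem_filter.1 hi).2 (Finset.mem_image.2 ⟨i, ?_, rfl⟩)
  simpa using h

lemma harmonicMean_nonneg (L : List ℕ) : 0 ≤ harmonicMean L := by
  rw [harmonicMean_eq]
  refine div_nonneg (Nat.cast_nonneg _) (List.sum_nonneg fun x hx => ?_)
  obtain ⟨a, -, rfl⟩ := List.mem_map.1 hx
  positivity

/-- With at least one jump and blocks of length at least `4`, all logarithms are at least `1` and
the remainder of the oracle inequality is of the order of the rate. -/
lemma remainder_le_rate {σ γ δ : ℝ} (hδ₀ : 0 < δ) (hδ₁ : δ < 1) {n s H : ℝ} (hs : 1 ≤ s)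
    (hn : 4 * (s + 1) ≤ n) (hH : 0 ≤ H) :
    8 * Real.log (2 / δ) * σ ^ 2 / n + 4 * σ ^ 2 * ((s + 1) / n)
        + 8 * σ ^ 2 * Real.log (4 * (n - s - 1) / δ) *
          (2 * γ ^ 2 * s / H + 5 * ((s + 1) / n) * Real.log (n / (s + 1)))
      ≤ (8 * σ ^ 2 * Real.log (2 / δ) + 8 * σ ^ 2
          + 8 * σ ^ 2 * (Real.log (4 / δ) + 1) * (2 * γ ^ 2 + 10)) * (Real.log n * s / H)
        + (8 * σ ^ 2 * Real.log (2 / δ) + 8 * σ ^ 2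
          + 8 * σ ^ 2 * (Real.log (4 / δ) + 1) * (2 * γ ^ 2 + 10))
            * (Real.log n * Real.log (n / s) * s / n) := by
  have hn0 : 0 < n := by linarith
  have hs0 : 0 < s := by linarith
  have he : Real.exp 1 ≤ 4 := by linarith [Real.exp_one_lt_d9]
  have hlogn : 1 ≤ Real.log n := (Real.le_log_iff_exp_le hn0).2 (by linarith)
  have hlogns : 1 ≤ Real.log (n / s) :=
    (Real.le_log_iff_exp_le (by positivity)).2 (by rw [le_div_iff₀ hs0]; nlinarith)
  have hl2 : 0 ≤ Real.log (2 / δ) := Real.log_nonneg (by rw [le_div_iff₀ hδ₀]; linarith)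
  have hl4 : 0 ≤ Real.log (4 / δ) := Real.log_nonneg (by rw [le_div_iff₀ hδ₀]; linarith)
  have hlogL : Real.log (4 * (n - s - 1) / δ) ≤ (Real.log (4 / δ) + 1) * Real.log n := by
    calc Real.log (4 * (n - s - 1) / δ) ≤ Real.log (4 / δ * n) := by
          refine Real.log_le_log (div_pos (by linarith) hδ₀) ?_
          rw [div_mul_eq_mul_div]
          gcongr
          linarith
      _ = Real.log (4 / δ) + Real.log n := Real.log_mul (by positivity) hn0.ne'
      _ ≤ _ := by nlinarith
  have hlogs1 : Real.log (n / (s + 1)) ≤ Real.log (n / s) :=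
    Real.log_le_log (by positivity) (by gcongr; linarith)
  have hlogs0 : 0 ≤ Real.log (n / (s + 1)) :=
    Real.log_nonneg (by rw [le_div_iff₀ (by linarith)]; linarith)
  set l := Real.log n
  set m := Real.log (n / s)
  set A := Real.log (4 / δ) + 1
  have hA : 0 ≤ A := by linarith
  have hlm : 1 ≤ l * m := one_le_mul_of_one_le_of_one_le hlogn hlogns
  set X := l * s / H with hX
  set Y := l * m * s / n with hY
  have hX0 : 0 ≤ X := by positivity
  have hY0 : 0 ≤ Y := by positivity
  have hsn : s / n ≤ Y := by
    rw [hY]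
    gcongr
    nlinarith
  have h1n : 1 / n ≤ Y := le_trans (by gcongr) hsn
  have hs1n : (s + 1) / n ≤ 2 * (s / n) := by
    rw [← mul_div_assoc]
    gcongr
    linarith
  have t1 : 8 * Real.log (2 / δ) * σ ^ 2 / n ≤ 8 * σ ^ 2 * Real.log (2 / δ) * Y := by
    rw [show 8 * Real.log (2 / δ) * σ ^ 2 / n = 8 * σ ^ 2 * Real.log (2 / δ) * (1 / n) by ring]
    gcongr
  have t2 : 4 * σ ^ 2 * ((s + 1) / n) ≤ 8 * σ ^ 2 * Y := by
    have := mul_le_mul_of_nonneg_left (hs1n.trans (mul_le_mul_of_nonneg_left hsn zero_le_two))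
      (by positivity : 0 ≤ 4 * σ ^ 2)
    linarith
  have t3 : 8 * σ ^ 2 * Real.log (4 * (n - s - 1) / δ) *
      (2 * γ ^ 2 * s / H + 5 * ((s + 1) / n) * Real.log (n / (s + 1)))
      ≤ 8 * σ ^ 2 * A * (2 * γ ^ 2 * X + 10 * Y) := by
    calc _ ≤ 8 * σ ^ 2 * (A * l) * (2 * γ ^ 2 * s / H + 5 * (2 * (s / n)) * m) := by
          gcongr
      _ = _ := by rw [hX, hY]; ring
  have hq : 0 ≤ 8 * σ ^ 2 * A := by positivity
  have r1 : 0 ≤ (8 * σ ^ 2 * Real.log (2 / δ) + 8 * σ ^ 2 + 8 * σ ^ 2 * A * 10) * X := by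
    positivity
  have r2 : 0 ≤ 8 * σ ^ 2 * A * (2 * γ ^ 2) * Y := by positivity
  linarith

lemma four_mul_succ_le {n s : ℕ} {d : ℕ → ℕ} (hn : ∑ i ∈ Finset.Icc 1 (s + 1), d i = n)
    (hd : ∀ i ∈ Finset.Icc 1 (s + 1), 4 ≤ d i) : 4 * (s + 1) ≤ n := by
  have := Finset.card_nsmul_le_sum _ _ _ hd
  rw [hn, Nat.card_Icc, smul_eq_mul] at this
  omega

theorem corollary4p3 (σ γ δ : ℝ) (hσ : 0 < σ) (hγ : 1 < γ) (hδ₀ : 0 < δ) (hδ₁ : δ < 1) :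
    -- the oracle inequality
    (∀ (n s : ℕ) (d : ℕ → ℕ),
      (∑ i ∈ Finset.Icc 1 (s + 1), d i) = n →
      (∀ i ∈ Finset.Icc 1 (s + 1), 4 ≤ d i) →
      ∀ (f₀ : Fin n → ℝ) (Ω : Type*) [MeasurableSpace Ω] (P : Measure Ω) [IsProbabilityMeasure P]
        (ε : Ω → Fin n → ℝ) (fhat : Ω → Fin n → ℝ),
        HasLaw ε (gaussianNoise n σ) P →
        (∀ ω, IsTVEstimator (tuningParameter γ σ δ n s) (f₀ + ε ω) (fhat ω)) →
        ENNReal.ofReal (1 - δ) ≤ P {ω |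
          sqNorm (fhat ω - f₀) ≤
            (⨅ f : Fin n → ℝ,
              sqNorm (f - f₀) + 4 * tuningParameter γ σ δ n s * pathTVOff (jumpSet s d) f)
            + 8 * Real.log (2 / δ) * σ ^ 2 / n
            + 4 * σ ^ 2 * (((s : ℝ) + 1) / n)
            + 8 * σ ^ 2 * Real.log (4 * ((n : ℝ) - s - 1) / δ) *
              (2 * γ ^ 2 * s / harmonicMean (halfDistances s d)
                + 5 * (((s : ℝ) + 1) / n) * Real.log (n / ((s : ℝ) + 1)))}) ∧
    -- the rate, for `S = S₀` with at least one jump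
    (∃ C : ℝ, 0 < C ∧ ∀ (n s₀ : ℕ) (d : ℕ → ℕ),
      1 ≤ s₀ →
      (∑ i ∈ Finset.Icc 1 (s₀ + 1), d i) = n →
      (∀ i ∈ Finset.Icc 1 (s₀ + 1), 4 ≤ d i) →
      ∀ (f₀ : Fin n → ℝ),
        activeSet f₀ = jumpSet s₀ d →
        ∀ (Ω : Type*) [MeasurableSpace Ω] (P : Measure Ω) [IsProbabilityMeasure P]
          (ε : Ω → Fin n → ℝ) (fhat : Ω → Fin n → ℝ),
          HasLaw ε (gaussianNoise n σ) P →
          (∀ ω, IsTVEstimator (tuningParameter γ σ δ n s₀) (f₀ + ε ω) (fhat ω)) →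
          ENNReal.ofReal (1 - δ) ≤ P {ω |
            sqNorm (fhat ω - f₀) ≤
              C * (Real.log n * s₀ / harmonicMean (halfDistances s₀ d))
              + C * (Real.log n * Real.log ((n : ℝ) / s₀) * s₀ / n)}) := by
  refine ⟨?_, ?_⟩
  · intro n s d hn hd f₀ Ω _ P _ ε fhat hε hf
    refine (oracle_inequality_whp hσ hγ hδ₀ hδ₁ hn hd f₀ P hε hf).trans (measure_mono ?_)
    intro ω hω
    have hω : ∀ f : Fin n → ℝ, _ := hω
    rw [Set.mem_ofPred_eq, add_assoc, add_assoc, ← sub_le_iff_le_add]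
    refine le_ciInf fun f => ?_
    rw [sub_le_iff_le_add]
    linarith [hω f]
  · have hl2 : 0 < Real.log (2 / δ) := Real.log_pos (by rw [lt_div_iff₀ hδ₀]; linarith)
    have hl4 : 0 < Real.log (4 / δ) := Real.log_pos (by rw [lt_div_iff₀ hδ₀]; linarith)
    refine ⟨8 * σ ^ 2 * Real.log (2 / δ) + 8 * σ ^ 2
      + 8 * σ ^ 2 * (Real.log (4 / δ) + 1) * (2 * γ ^ 2 + 10), by positivity, ?_⟩
    intro n s₀ d hs hn hd f₀ hact Ω _ P _ ε fhat hε hf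
    refine (oracle_inequality_whp hσ hγ hδ₀ hδ₁ hn hd f₀ P hε hf).trans (measure_mono ?_)
    intro ω hω
    have hω := hω f₀
    rw [← hact, pathTVOff_activeSet, sub_self, mul_zero, add_zero,
      show sqNorm (0 : Fin n → ℝ) = 0 by simp [sqNorm], zero_add] at hω
    exact hω.trans (remainder_le_rate hδ₀ hδ₁ (by exact_mod_cast hs)
      (by exact_mod_cast four_mul_succ_le hn hd) (harmonicMean_nonneg _))
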